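/- An instance of the scheduling problem $P|\text{partition}|\sum_j C_j$ consists of $m$ identical parallel machines, a finite set $J$ of jobs with processing times $p_j \ge 0$, and a collection $R$ of subsets of $J$, called resources, such that every job is contained in exactly one $r \in R$; a job $j$ uses the resource $r$ if $j \in r$. A schedule assigns to each job $j$ a machine and a starting time $s_j \ge 0$; the job is then processed without interruption (no preemption) on that machine during $[s_j, C_j)$, where $C_j = s_j + p_j$ is its completion time. A schedule is feasible if no two distinct jobs on the same machine and no two distinct jobs using the same resource are processed at the same time, and it is optimal if it is feasible and minimizes the total completion time $\sum_{j \in J} C_j$ among all feasible schedules. Theorem. In every optimal schedule for $P|\text{partition}|\sum_j C_j$, all jobs sharing the same resource are processed in SPT (shortest processing time) order, i.e., if jobs $j$ and $j'$ both use resource $r \in R$ and $p_j < p_{j'}$, then $C_j < C_{j'}$. -/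

import Mathlib

/-- An instance of `P|partition|∑ C_j` with finite set of jobs `J`: `m` identical machines, a
processing time `p j` for each job, and a collection `R` of subsets of `J` (the resources) such that
every job is contained in exactly one of them. -/
structure PartitionInstance (J : Type*) where
  /-- number of identical parallel machines -/
  m : ℕ
  /-- processing times -/
  p : J → ℝ
  p_nonneg : ∀ j, 0 ≤ p j
  /-- the resources; `r ∈ R` is identified with the set of jobs that use it -/
  R : Finset (Finset J)
  partition : ∀ j, ∃! r, r ∈ R ∧ j ∈ r

namespace PartitionInstance

/-- A (non-preemptive) assignment of a machine and a starting time to each job; job `j` is then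
processed on machine `machine j` without interruption from time `start j` on. -/
structure Schedule {J : Type*} (I : PartitionInstance J) where
  machine : J → Fin I.m
  start : J → ℝ

namespace Schedule

variable {J : Type*} {I : PartitionInstance J}

/-- The completion time `C_j` of job `j`. -/
noncomputable def completion (S : Schedule I) (j : J) : ℝ := S.start j + I.p j

/-- The period of time in which job `j` is being processed. -/
def processing (S : Schedule I) (j : J) : Set ℝ := Set.Ico (S.start j) (S.completion j)

/-- A schedule is feasible if no job starts before time `0`, each machine processes at most one job
at a time, and no two jobs that share a resource are processed at the same time. -/
structure Feasible (S : Schedule I) : Prop where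
  start_nonneg : ∀ j, 0 ≤ S.start j
  machine_disjoint : ∀ j j', j ≠ j' → S.machine j = S.machine j' →
    Disjoint (S.processing j) (S.processing j')
  resource_disjoint : ∀ r ∈ I.R, ∀ j ∈ r, ∀ j' ∈ r, j ≠ j' →
    Disjoint (S.processing j) (S.processing j')

/-- The objective `∑ C_j`. -/
noncomputable def totalCompletion [Fintype J] (S : Schedule I) : ℝ := ∑ j, S.completion j

/-- A schedule is optimal if it is feasible and minimizes the total completion time among all
feasible schedules. -/
def Optimal [Fintype J] (S : Schedule I) : Prop :=
  S.Feasible ∧ ∀ S' : Schedule I, S'.Feasible → S.totalCompletion ≤ S'.totalCompletion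

end Schedule

end PartitionInstance

/-! The proof varies the job lengths along segments `p + x d`. If the later jobs on each machine are
shifted along, the cost of a fixed schedule changes linearly, with slope `∑ d i * n i`, where `n i`
(`tailCount`) counts `i` and the positive jobs behind it on its machine. Such shifts are harmless to
resources once back-to-back jobs of one resource share a machine, which exchanging machine tails
achieves (`Compat.exists_aligned`). Since a cheapest schedule inside a segment can be moved both
ways, the minimum cost is quasi-concave along the segment (`le_cost_of_endpoints`). So if the far
end of the segment is no cheaper than a given optimal schedule, the slope at that schedule is
nonnegative (`nonneg_slope_of_endpoints`).

Let `a`, `b` be consecutive jobs of one resource, `a` first, and suppose `p a > p b > 0`. Moving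
length from `a` to `b` until the two lengths are interchanged yields the same instance up to
renaming, so `n a ≤ n b` (`IsBest.tailCount_le`). Hence `a` and `b` are on different machines, and
optimality provides a job `k` behind `a` on its machine that runs at least until `b` starts
(`IsBest.exists_straddling`). Moving length from `b` to `k`, with all starts up to that of `b`
frozen, leads to schedules that convert back at no extra cost (`Compat.exchange`, `Compat.insert`),
so `n b ≤ n k`. But `n k < n a`, a contradiction. A closest violating pair is consecutive, which
settles the general case. -/

open Filter Topology

namespace PartitionInstance

/-! ### Separation, compatibility and alignment -/

section Sweep

variable {J ρ μ : Type*}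

/-- Two jobs are separated in time (jobs without positive length never collide). -/
def Sep (p s : J → ℝ) (i j : J) : Prop :=
  p i ≤ 0 ∨ p j ≤ 0 ∨ s i + p i ≤ s j ∨ s j + p j ≤ s i

/-- Jobs on a common machine or with a common resource are separated. -/
def Compat (res : J → ρ) (p : J → ℝ) (M : J → μ) (s : J → ℝ) : Prop :=
  ∀ i j, i ≠ j → (M i = M j ∨ res i = res j) → Sep p s i j

/-- Jobs of the same resource that are processed back to back are on the same machine. -/
def Aligned (res : J → ρ) (p : J → ℝ) (M : J → μ) (s : J → ℝ) : Prop :=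
  ∀ i j, 0 < p i → 0 < p j → res i = res j → s i + p i = s j → M i = M j

/-- Compatible schedules with the starting times `σ` prescribed on `A`, all other jobs starting no
earlier than `τ`. -/
structure Extends (res : J → ρ) (A : Set J) (σ : J → ℝ) (τ : ℝ)
    (p : J → ℝ) (M : J → μ) (s : J → ℝ) : Prop where
  compat : Compat res p M s
  fixed : ∀ i ∈ A, s i = σ i
  release : ∀ i ∉ A, τ ≤ s i

open Classical in
/-- The total change of the lengths of the jobs that precede `j` on its machine. -/
noncomputable def shift [Fintype J] (p : J → ℝ) (M : J → μ) (s d : J → ℝ) (j : J) : ℝ :=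
  if 0 < p j then ∑ i, if M i = M j ∧ s i < s j then d i else 0 else 0

open Classical in
/-- The number of jobs on the machine of `i` from `i` on. -/
noncomputable def tailCount [Fintype J] (p : J → ℝ) (M : J → μ) (s : J → ℝ) (i : J) : ℝ :=
  1 + ((Finset.univ.filter fun j => 0 < p j ∧ M i = M j ∧ s i < s j).card : ℝ)

theorem Sep.of_pos {p s : J → ℝ} {i j : J} (h : Sep p s i j) (hi : 0 < p i) (hj : 0 < p j) :
    s i + p i ≤ s j ∨ s j + p j ≤ s i := by
  rcases h with h | h | h | h
  · linarith
  · linarith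
  · exact .inl h
  · exact .inr h

theorem Sep.le_of_lt {p s : J → ℝ} {i j : J} (h : Sep p s i j) (hi : 0 < p i) (hj : 0 < p j)
    (hlt : s i < s j) : s i + p i ≤ s j := by
  rcases h.of_pos hi hj with h | h
  · exact h
  · linarith

theorem sep_of_pos {p s : J → ℝ} {i j : J}
    (h : 0 < p i → 0 < p j → s i + p i ≤ s j ∨ s j + p j ≤ s i) : Sep p s i j := by
  unfold Sep
  by_cases hi : 0 < p i
  · by_cases hj : 0 < p j
    · exact .inr (.inr (h hi hj))
    · exact .inr (.inl (not_lt.1 hj))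
  · exact .inl (not_lt.1 hi)

/-! ### Exchanging machine tails -/

open Classical in
/-- Exchange the machines `u` and `v` from time `t` on. -/
noncomputable def swapTails (M : J → μ) (s : J → ℝ) (u v : μ) (t : ℝ) (j : J) : μ :=
  if t ≤ s j then Equiv.swap u v (M j) else M j

theorem swapTails_eq {M : J → μ} {s : J → ℝ} {u v : μ} {t : ℝ} {i j : J}
    (h : swapTails M s u v t i = swapTails M s u v t j) :
    M i = M j ∨ (s i < t ∧ t ≤ s j ∧ (M i = u ∨ M i = v)) ∨
      (s j < t ∧ t ≤ s i ∧ (M j = u ∨ M j = v)) := by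
  classical
  unfold swapTails at h
  split_ifs at h with h1 h2 h2
  · exact .inl ((Equiv.swap u v).injective h)
  · by_cases hu : M j = u ∨ M j = v
    · exact .inr (.inr ⟨not_le.1 h2, h1, hu⟩)
    · push Not at hu
      rw [← Equiv.swap_apply_of_ne_of_ne hu.1 hu.2] at h
      exact .inl ((Equiv.swap u v).injective h)
  · by_cases hu : M i = u ∨ M i = v
    · exact .inr (.inl ⟨not_le.1 h1, h2, hu⟩)
    · push Not at hu
      rw [← Equiv.swap_apply_of_ne_of_ne hu.1 hu.2] at h
      exact .inl ((Equiv.swap u v).injective h)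
  · exact .inl h

/-- Two jobs can newly meet on a machine only if one starts before `t` and the other does not; by
`ht` the earlier one is finished by `t`. -/
theorem Compat.exchange_tails {res : J → ρ} {p : J → ℝ} {M : J → μ} {s : J → ℝ}
    (h : Compat res p M s) {u v : μ} {t : ℝ}
    (ht : ∀ j, 0 < p j → M j = u ∨ M j = v → s j < t → s j + p j ≤ t) :
    Compat res p (swapTails M s u v t) s := by
  intro i j hij hc
  rcases hc with hc | hc
  · rcases swapTails_eq hc with hc | ⟨h1, h2, h3⟩ | ⟨h1, h2, h3⟩
    · exact h i j hij (.inl hc)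
    · exact sep_of_pos fun hi _ => .inl ((ht i hi h3 h1).trans h2)
    · exact sep_of_pos fun _ hj => .inr ((ht j hj h3 h1).trans h2)
  · exact h i j hij (.inr hc)

-- Choose `M'` with the most back-to-back pairs of a common resource on a common machine. If a pair
-- `(i, j)` were still split, exchanging the tails of its two machines at `s j` would gain it and
-- lose none.
open Classical in
theorem Compat.exists_aligned [Fintype J] [Finite μ] {res : J → ρ} {p : J → ℝ} {M : J → μ}
    {s : J → ℝ} (h : Compat res p M s) :
    ∃ M' : J → μ, Compat res p M' s ∧ Aligned res p M' s := by
  let G : (J → μ) → Finset (J × J) := fun M => Finset.univ.filter fun q =>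
    (0 < p q.1 ∧ 0 < p q.2 ∧ res q.1 = res q.2 ∧ s q.1 + p q.1 = s q.2) ∧ M q.1 = M q.2
  obtain ⟨M', hM', hmax⟩ := Set.exists_max_image {M : J → μ | Compat res p M s}
    (fun M => (G M).card) (Set.toFinite _) ⟨M, h⟩
  refine ⟨M', hM', fun i j hi hj hr hs => ?_⟩
  by_contra hne
  have hstr : ∀ l, 0 < p l → M' l = M' i ∨ M' l = M' j → s l < s j → s l + p l ≤ s j := by
    intro l hl hm hlt
    rcases hm with hm | hm
    · by_cases hli : l = i
      · rw [hli, hs]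
      · rcases (hM' l i hli (.inl hm)).of_pos hl hi with h1 | h1
        · linarith
        · linarith
    · by_cases hlj : l = j
      · rw [hlj] at hlt; exact absurd hlt (lt_irrefl _)
      · exact (hM' l j hlj (.inl hm)).le_of_lt hl hj hlt
  have hc := hM'.exchange_tails hstr
  have hlt : (G M').card < (G (swapTails M' s (M' i) (M' j) (s j))).card := by
    apply Finset.card_lt_card
    rw [Finset.ssubset_iff_of_subset]
    · refine ⟨(i, j), ?_, ?_⟩
      · have hlt : s i < s j := by linarith
        refine Finset.mem_filter.2 ⟨Finset.mem_univ _, ⟨hi, hj, hr, hs⟩, ?_⟩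
        simp [swapTails, hlt.not_ge]
      · simp [G, hne]
    · rintro ⟨a, b⟩ hab
      simp only [G, Finset.mem_filter, Finset.mem_univ, true_and] at hab ⊢
      obtain ⟨⟨ha, hb, hrab, hsab⟩, hm⟩ := hab
      refine ⟨⟨ha, hb, hrab, hsab⟩, ?_⟩
      have hsa : s a < s b := by linarith
      unfold swapTails
      by_cases h1 : s j ≤ s a
      · rw [if_pos h1, if_pos (h1.trans hsa.le), hm]
      · by_cases h2 : s j ≤ s b
        · rw [if_neg h1, if_pos h2]
          push Not at h1
          -- A pair torn apart by the exchange would straddle `s j` on one of the two machines. The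
          -- machine and resource constraints then force `(a, b) = (i, j)`, contrary to `hne`.
          have hne' : M' b ≠ M' i ∧ M' b ≠ M' j := by
            constructor
            · intro hbi
              have hai : a = i := by
                by_contra hai
                rcases (hM' a i hai (.inl (hm.trans hbi))).of_pos ha hi with h3 | h3 <;> linarith
              have hbj : b = j := by
                subst hai
                by_contra hbj
                rcases (hM' b j hbj (.inr (hrab.symm.trans hr))).of_pos hb hj with h3 | h3 <;>
                  linarith
              exact hne (by rw [← hbi, hbj])
            · intro hbj'
              have hle : s a + p a ≤ s j := by
                refine hstr a ha (.inr (hm.trans hbj')) h1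
              have hbj : b = j := by
                by_contra hbj
                rcases (hM' b j hbj (.inl hbj')).of_pos hb hj with h3 | h3 <;> linarith
              have hai : a = i := by
                subst hbj
                by_contra hai
                rcases (hM' a i hai (.inr (hrab.trans hr.symm))).of_pos ha hi with h3 | h3 <;>
                  linarith
              exact hne (by rw [← hai, ← hbj, hm])
          rw [Equiv.swap_apply_of_ne_of_ne hne'.1 hne'.2, hm]
        · rw [if_neg h1, if_neg h2, hm]
  exact absurd (hmax _ hc) (not_le.2 hlt)

/-! ### First-order variation of the lengths -/

section Shift

variable [Fintype J] {res : J → ρ} {p : J → ℝ} {M : J → μ} {s d : J → ℝ}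

theorem shift_neg (j : J) : shift p M s (-d) j = -shift p M s d j := by
  classical
  unfold shift
  split_ifs
  · rw [← Finset.sum_neg_distrib]
    refine Finset.sum_congr rfl fun i _ => ?_
    split_ifs <;> simp
  · simp

/-- A job with nonzero `d` has positive length, so on this machine it cannot start strictly between
`i` and `j` or together with `i`. The relevant predecessors of `j` are those of `i` and `i` itself.
-/
theorem shift_of_back_to_back (h : Compat res p M s) (hd : ∀ i, d i ≠ 0 → 0 < p i) {i j : J}
    (hi : 0 < p i) (hj : 0 < p j) (hm : M i = M j) (hs : s i + p i = s j) :
    shift p M s d j = shift p M s d i + d i := by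
  classical
  unfold shift
  rw [if_pos hi, if_pos hj]
  have : d i = ∑ l, if l = i then d l else 0 := by simp
  conv_rhs => rw [this]
  rw [← Finset.sum_add_distrib]
  refine Finset.sum_congr rfl fun l _ => ?_
  by_cases hl : d l = 0
  · simp [hl]
  · have hl := hd l hl
    by_cases hli : l = i
    · subst hli
      have : s l < s j := by linarith
      simp [hm, this]
    · by_cases hlm : M l = M j
      · have h1 := (h l i hli (.inl (hlm.trans hm.symm))).of_pos hl hi
        have : s l < s j ↔ s l < s i := by
          constructor <;> intro h2
          · rcases h1 with h1 | h1 <;> linarith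
          · linarith
        simp [hli, hlm, hm, this]
      · simp [hli, hlm, hm]

/-- Double counting: `d i` enters once for `i` itself and once for each positive job behind it. -/
theorem sum_shift_add (p : J → ℝ) (M : J → μ) (s d : J → ℝ) :
    ∑ j, (shift p M s d j + d j) = ∑ i, d i * tailCount p M s i := by
  classical
  have h1 : ∀ j, shift p M s d j = ∑ i, if 0 < p j ∧ M i = M j ∧ s i < s j then d i else 0 := by
    intro j
    unfold shift
    by_cases hj : 0 < p j <;> simp [hj]
  simp only [h1]
  rw [Finset.sum_add_distrib, Finset.sum_comm, ← Finset.sum_add_distrib]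
  refine Finset.sum_congr rfl fun i _ => ?_
  rw [tailCount, Finset.sum_ite, Finset.sum_const_zero, Finset.sum_const, nsmul_eq_mul]
  ring

theorem eventually_add_mul_le {a b : ℝ} (x y : ℝ) (h : a < b) :
    ∀ᶠ ε in 𝓝[>] (0 : ℝ), a + ε * x ≤ b + ε * y := by
  have h1 : Tendsto (fun ε : ℝ => a + ε * x) (𝓝 0) (𝓝 (a + 0 * x)) :=
    Continuous.tendsto (by fun_prop) 0
  have h2 : Tendsto (fun ε : ℝ => b + ε * y) (𝓝 0) (𝓝 (b + 0 * y)) :=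
    Continuous.tendsto (by fun_prop) 0
  have := (h1.eventually_lt h2 (by simpa using h)).filter_mono
    (nhdsWithin_le_nhds (s := Set.Ioi (0 : ℝ)))
  exact this.mono fun _ h => h.le

/-- In an aligned schedule the lengths may be changed in the direction `d` if the later jobs on each
machine are shifted accordingly. -/
theorem Extends.eventually_shift {A : Set J} {σ : J → ℝ} {τ : ℝ}
    (h : Extends res A σ τ p M s) (ha : Aligned res p M s) (hd : ∀ i, d i ≠ 0 → 0 < p i)
    (hA : ∀ j ∈ A, shift p M s d j = 0) (hτ : ∀ j ∉ A, s j = τ → 0 ≤ shift p M s d j) :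
    ∀ᶠ ε in 𝓝[>] (0 : ℝ),
      Extends res A σ τ (fun j => p j + ε * d j) M (fun j => s j + ε * shift p M s d j) := by
  have key : ∀ i j, 0 < p i → 0 < p j → (M i = M j ∨ res i = res j) → s i + p i ≤ s j →
      ∀ᶠ ε in 𝓝[>] (0 : ℝ), s i + ε * shift p M s d i + (p i + ε * d i) ≤
        s j + ε * shift p M s d j := by
    intro i j hi hj hc hle
    rcases hle.lt_or_eq with hlt | heq
    · refine (eventually_add_mul_le (shift p M s d i + d i) (shift p M s d j) hlt).mono ?_
      intro ε hε
      linarith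
    · have hm : M i = M j := by
        rcases hc with hc | hc
        · exact hc
        · exact ha i j hi hj hc heq
      rw [shift_of_back_to_back h.compat hd hi hj hm heq]
      exact Eventually.of_forall fun ε => by rw [← heq]; linarith
  have h1 : ∀ᶠ ε in 𝓝[>] (0 : ℝ), ∀ i j, i ≠ j → (M i = M j ∨ res i = res j) →
      Sep (fun j => p j + ε * d j) (fun j => s j + ε * shift p M s d j) i j := by
    refine eventually_all.2 fun i => eventually_all.2 fun j => ?_
    by_cases hij : i ≠ j ∧ (M i = M j ∨ res i = res j)
    swap
    · exact Eventually.of_forall fun ε h1 h2 => absurd ⟨h1, h2⟩ hij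
    have hz : ∀ l, p l ≤ 0 → ∀ ε : ℝ, p l + ε * d l ≤ 0 := by
      intro l hl ε
      have : d l = 0 := by
        by_contra hne
        exact absurd (hd l hne) (not_lt.2 hl)
      simpa [this] using hl
    by_cases hi : 0 < p i
    swap
    · exact Eventually.of_forall fun ε _ _ => .inl (hz i (not_lt.1 hi) ε)
    by_cases hj : 0 < p j
    swap
    · exact Eventually.of_forall fun ε _ _ => .inr (.inl (hz j (not_lt.1 hj) ε))
    rcases (h.compat i j hij.1 hij.2).of_pos hi hj with hle | hle
    · exact (key i j hi hj hij.2 hle).mono fun ε hε _ _ => .inr (.inr (.inl hε))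
    · exact (key j i hj hi (hij.2.imp Eq.symm Eq.symm) hle).mono
        fun ε hε _ _ => .inr (.inr (.inr hε))
  have h2 : ∀ᶠ ε in 𝓝[>] (0 : ℝ), ∀ j, j ∉ A → τ ≤ s j + ε * shift p M s d j := by
    refine eventually_all.2 fun j => ?_
    by_cases hj : j ∈ A
    · exact Eventually.of_forall fun ε hn => absurd hj hn
    rcases (h.release j hj).lt_or_eq with hlt | heq
    · refine (eventually_add_mul_le 0 (shift p M s d j) hlt).mono fun ε hε _ => ?_
      simpa using hε
    · filter_upwards [self_mem_nhdsWithin] with ε hε _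
      have := mul_nonneg (le_of_lt hε) (hτ j hj heq.symm)
      linarith
  filter_upwards [h1, h2] with ε h1 h2
  exact ⟨h1, fun i hi => by simp [hA i hi, h.fixed i hi], h2⟩

theorem sum_shifted (p : J → ℝ) (M : J → μ) (s d : J → ℝ) (ε : ℝ) :
    ∑ j, (s j + ε * shift p M s d j + (p j + ε * d j)) =
      ∑ j, (s j + p j) + ε * ∑ i, d i * tailCount p M s i := by
  rw [← sum_shift_add, Finset.mul_sum, ← Finset.sum_add_distrib]
  exact Finset.sum_congr rfl fun j _ => by ring

end Shift

/-! ### Quasi-concavity of the minimum cost -/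

theorem isClosed_extends [TopologicalSpace μ] [DiscreteTopology μ] (res : J → ρ)
    (A : Set J) (σ : J → ℝ) (τ : ℝ) (p d : J → ℝ) :
    IsClosed {q : ℝ × (J → μ) × (J → ℝ) |
      Extends res A σ τ (fun j => p j + q.1 * d j) q.2.1 q.2.2} := by
  have : {q : ℝ × (J → μ) × (J → ℝ) |
      Extends res A σ τ (fun j => p j + q.1 * d j) q.2.1 q.2.2} =
      {q | Compat res (fun j => p j + q.1 * d j) q.2.1 q.2.2} ∩
      ({q | ∀ i ∈ A, q.2.2 i = σ i} ∩ {q | ∀ i ∉ A, τ ≤ q.2.2 i}) := by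
    ext q
    exact ⟨fun h => ⟨h.1, h.2, h.3⟩, fun h => ⟨h.1, h.2.1, h.2.2⟩⟩
  rw [this]
  refine IsClosed.inter ?_ (IsClosed.inter ?_ ?_)
  · simp only [Compat, Set.ofPred_forall]
    refine isClosed_iInter fun i => isClosed_iInter fun j => isClosed_iInter fun _ => ?_
    have hsep : IsClosed {q : ℝ × (J → μ) × (J → ℝ) |
        Sep (fun j => p j + q.1 * d j) q.2.2 i j} := by
      simp only [Sep, Set.ofPred_or]
      refine IsClosed.union (isClosed_le (by fun_prop) (by fun_prop)) (IsClosed.union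
        (isClosed_le (by fun_prop) (by fun_prop)) (IsClosed.union
        (isClosed_le (by fun_prop) (by fun_prop)) (isClosed_le (by fun_prop) (by fun_prop))))
    -- Since `μ` is discrete, coincidence of machines is an open condition, so "no conflict or
    -- separated" is closed.
    have hopen : IsOpen {q : ℝ × (J → μ) × (J → ℝ) | q.2.1 i = q.2.1 j ∨ res i = res j} := by
      have hc : Continuous fun q : ℝ × (J → μ) × (J → ℝ) => (q.2.1 i, q.2.1 j) := by fun_prop
      exact (isOpen_discrete {z : μ × μ | z.1 = z.2 ∨ res i = res j}).preimage hc
    have := hopen.isClosed_compl.union hsep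
    convert this using 1
    ext q
    simp only [Set.mem_ofPred_eq, Set.mem_union, Set.mem_compl_iff]
    tauto
  · simp only [Set.ofPred_forall]
    exact isClosed_iInter fun i => isClosed_iInter fun _ =>
      isClosed_eq (by fun_prop) (by fun_prop)
  · simp only [Set.ofPred_forall]
    exact isClosed_iInter fun i => isClosed_iInter fun _ =>
      isClosed_le (by fun_prop) (by fun_prop)

/-- A job of changing length ends after `τ`: by `hAd` if it is fixed, otherwise because it starts no
earlier than `τ` and has positive length. So it cannot precede a positive job that starts by `τ`. -/
theorem shift_eq_zero_of_start_le [Fintype J] {res : J → ρ} {p : J → ℝ} {M : J → μ} {s d : J → ℝ}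
    {A : Set J} {σ : J → ℝ} {τ : ℝ} (h : Extends res A σ τ p M s) (hd : ∀ i, d i ≠ 0 → 0 < p i)
    (hAd : ∀ i ∈ A, d i ≠ 0 → τ < σ i + p i) {j : J} (hj : s j ≤ τ) : shift p M s d j = 0 := by
  classical
  unfold shift
  split_ifs with hpj
  · refine Finset.sum_eq_zero fun i _ => ?_
    split_ifs with hij
    · by_contra hdi
      have hne : i ≠ j := fun e => absurd hij.2 (by rw [e]; exact lt_irrefl _)
      have hle := (h.compat i j hne (.inl hij.1)).le_of_lt (hd i hdi) hpj hij.2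
      by_cases hi : i ∈ A
      · have := hAd i hi hdi
        rw [← h.fixed i hi] at this
        linarith
      · have := h.release i hi
        have := hd i hdi
        linarith
    · rfl
  · rfl

/-- The minimum total completion time is quasi-concave along segments in the space of lengths. -/
theorem le_cost_of_endpoints [Fintype J] [Finite μ] {res : J → ρ} {A : Set J} {σ : J → ℝ} {τ : ℝ}
    {p d : J → ℝ} {X c : ℝ}
    (hσ0 : ∀ i ∈ A, 0 ≤ σ i) (hτ0 : 0 ≤ τ) (hστ : ∀ i ∈ A, σ i ≤ τ)
    (hp : ∀ x ∈ Set.Icc 0 X, ∀ i, 0 ≤ p i + x * d i)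
    (hd : ∀ x ∈ Set.Ioo 0 X, ∀ i, d i ≠ 0 → 0 < p i + x * d i)
    (hAd : ∀ x ∈ Set.Ioo 0 X, ∀ i ∈ A, d i ≠ 0 → τ < σ i + (p i + x * d i))
    (h0 : ∀ (M : J → μ) s, Extends res A σ τ (fun j => p j + 0 * d j) M s →
      c ≤ ∑ j, (s j + (p j + 0 * d j)))
    (hX : ∀ (M : J → μ) s, Extends res A σ τ (fun j => p j + X * d j) M s →
      c ≤ ∑ j, (s j + (p j + X * d j)))
    {x : ℝ} (hx : x ∈ Set.Icc 0 X) {M : J → μ} {s : J → ℝ}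
    (h : Extends res A σ τ (fun j => p j + x * d j) M s) :
    c ≤ ∑ j, (s j + (p j + x * d j)) := by
  classical
  by_contra! hlt
  let _ : TopologicalSpace μ := ⊥
  have : DiscreteTopology μ := ⟨rfl⟩
  let cost : ℝ × (J → μ) × (J → ℝ) → ℝ := fun q => ∑ j, (q.2.2 j + (p j + q.1 * d j))
  have hcost : Continuous cost := by fun_prop
  -- Starting times may be confined to `[0, c]`: all summands of the cost are nonnegative, so a cost
  -- of at most `c` bounds each of them.
  let F : Set (ℝ × (J → μ) × (J → ℝ)) :=
    {q | Extends res A σ τ (fun j => p j + q.1 * d j) q.2.1 q.2.2} ∩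
      (Set.Icc 0 X ×ˢ (Set.univ ×ˢ Set.univ.pi fun _ => Set.Icc 0 c))
  have hF : IsCompact F := (isCompact_Icc.prod (isCompact_univ.prod
    (isCompact_univ_pi fun _ => isCompact_Icc))).inter_left (isClosed_extends res A σ τ p d)
  have hs0 : ∀ {p : J → ℝ} {M : J → μ} {s : J → ℝ}, Extends res A σ τ p M s → ∀ j, 0 ≤ s j := by
    intro p M s h j
    by_cases hj : j ∈ A
    · rw [h.fixed j hj]; exact hσ0 j hj
    · exact hτ0.trans (h.release j hj)
  have memF : ∀ (y : ℝ) (M : J → μ) (s : J → ℝ), y ∈ Set.Icc 0 X →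
      Extends res A σ τ (fun j => p j + y * d j) M s → cost (y, M, s) ≤ c → (y, M, s) ∈ F := by
    intro y M s hy h hc
    refine ⟨h, hy, Set.mem_univ _, fun j _ => ⟨hs0 h j, ?_⟩⟩
    have h1 := Finset.single_le_sum (f := fun j => s j + (p j + y * d j))
      (fun i _ => add_nonneg (hs0 h i) (hp y hy i)) (Finset.mem_univ j)
    have h2 := hp y hy j
    simp only [cost] at hc h1
    linarith
  have hqF := memF x M s hx h hlt.le
  obtain ⟨q, hq, hmin⟩ := hF.exists_isMinOn ⟨_, hqF⟩ hcost.continuousOn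
  -- Ties in cost are broken by the smallest parameter `y`, which turns out to be interior. Moving
  -- forward shows that the slope is nonnegative; moving backward then does not raise the cost but
  -- lowers `y`, a contradiction.
  have hF' : IsCompact (F ∩ {z | cost z ≤ cost q}) :=
    hF.inter_right (isClosed_le hcost continuous_const)
  obtain ⟨⟨y, N, t⟩, ⟨hz, hzq⟩, hzmin⟩ :=
    hF'.exists_isMinOn ⟨q, hq, le_refl (cost q)⟩ continuous_fst.continuousOn
  have hzc : cost (y, N, t) < c := lt_of_le_of_lt (le_trans hzq (hmin hqF)) hlt
  have hext : Extends res A σ τ (fun j => p j + y * d j) N t := hz.1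
  have hyI : y ∈ Set.Icc 0 X := hz.2.1
  have hy0 : y ≠ 0 := by
    rintro rfl
    exact absurd (h0 N t hext) (not_le.2 hzc)
  have hyX : y ≠ X := by
    rintro rfl
    exact absurd (hX N t hext) (not_le.2 hzc)
  have hy : y ∈ Set.Ioo 0 X := ⟨lt_of_le_of_ne hyI.1 (Ne.symm hy0), lt_of_le_of_ne hyI.2 hyX⟩
  obtain ⟨N', hN', hal⟩ := hext.compat.exists_aligned
  have hext' : Extends res A σ τ (fun j => p j + y * d j) N' t := ⟨hN', hext.2, hext.3⟩
  have hzero : ∀ j, t j ≤ τ → shift (fun j => p j + y * d j) N' t d j = 0 := fun j hj =>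
    shift_eq_zero_of_start_le hext' (hd y hy) (hAd y hy) hj
  have hzA : ∀ j ∈ A, shift (fun j => p j + y * d j) N' t d j = 0 := fun j hj =>
    hzero j (by rw [hext.fixed j hj]; exact hστ j hj)
  have hplus := hext'.eventually_shift hal (hd y hy) hzA (fun j _ hj => (hzero j hj.le).ge)
  have hminus := hext'.eventually_shift (d := -d) hal
    (fun i hi => hd y hy i (by simpa using hi))
    (fun j hj => by rw [shift_neg, hzA j hj, neg_zero])
    (fun j _ hj => by rw [shift_neg, hzero j hj.le, neg_zero])
  have hsmall1 : ∀ᶠ ε in 𝓝[>] (0 : ℝ), ε < y := nhdsWithin_le_nhds (gt_mem_nhds hy.1)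
  have hsmall2 : ∀ᶠ ε in 𝓝[>] (0 : ℝ), ε < X - y :=
    nhdsWithin_le_nhds (gt_mem_nhds (sub_pos.2 hy.2))
  obtain ⟨ε, hp1, hm1, hε1, hε2, hε0⟩ := (hplus.and (hminus.and (hsmall1.and
    (hsmall2.and self_mem_nhdsWithin)))).exists
  have hε0 : 0 < ε := hε0
  -- Both directions at once: `(e, d')` will be `(ε, d)` and `(-ε, -d)`.
  have step : ∀ (e : ℝ) (d' : J → ℝ), (∀ j, ε * d' j = e * d j) → y + e ∈ Set.Icc 0 X →
      Extends res A σ τ (fun j => p j + y * d j + ε * d' j) N'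
        (fun j => t j + ε * shift (fun j => p j + y * d j) N' t d' j) →
      (cost q ≤ cost (y, N, t) + ε * ∑ i, d' i * tailCount (fun j => p j + y * d j) N' t i) ∧
      (∑ i, d' i * tailCount (fun j => p j + y * d j) N' t i ≤ 0 → 0 ≤ e) := by
    intro e d' hed hye hE
    have hlen : (fun j => p j + y * d j + ε * d' j) = fun j => p j + (y + e) * d j := by
      funext j; rw [hed]; ring
    have hc : cost (y + e, N', fun j => t j + ε * shift (fun j => p j + y * d j) N' t d' j) =
        cost (y, N, t) + ε * ∑ i, d' i * tailCount (fun j => p j + y * d j) N' t i := by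
      have := sum_shifted (fun j => p j + y * d j) N' t d' ε
      simp only [cost]
      rw [← this]
      refine Finset.sum_congr rfl fun j _ => ?_
      rw [hed]; ring
    rw [hlen] at hE
    constructor
    · by_cases hle : cost (y + e, N', fun j => t j +
          ε * shift (fun j => p j + y * d j) N' t d' j) ≤ c
      · rw [← hc]; exact hmin (memF _ _ _ hye hE hle)
      · rw [← hc]
        exact (hmin hqF).trans (hlt.le.trans (not_le.1 hle).le)
    · intro hneg
      have h1 := mul_nonpos_of_nonneg_of_nonpos hε0.le hneg
      have h2 : cost (y, N, t) ≤ cost q := hzq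
      have h3 := memF _ _ _ hye hE (by linarith)
      have h4 := hzmin (show _ ∈ F ∩ {z | cost z ≤ cost q} from
        ⟨h3, show cost _ ≤ cost q by linarith⟩)
      have h4 : y ≤ y + e := h4
      linarith
  have s1 := step ε d (fun _ => rfl) ⟨by linarith [hy.1], by linarith⟩ hp1
  have s2 := step (-ε) (-d) (fun j => by simp) ⟨by linarith, by linarith [hy.2]⟩ hm1
  have hzq : cost (y, N, t) ≤ cost q := hzq
  have hnn : 0 ≤ ∑ i, d i * tailCount (fun j => p j + y * d j) N' t i := by
    by_contra hneg
    have := mul_neg_of_pos_of_neg hε0 (not_le.1 hneg)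
    linarith [s1.1]
  have := s2.2 (by simpa using hnn)
  linarith

/-- With a negative slope, a short step into the segment would undercut the cost of `(M, s)`, which
neither endpoint does. The range in `hd` omits `X`, so that a length may vanish there; the range in
`hAd` omits `0`, so that a fixed job may initially end exactly at `τ`. This is why `hA` and `hτ` are
required separately. -/
theorem nonneg_slope_of_endpoints [Fintype J] [Finite μ] {res : J → ρ} {A : Set J} {σ : J → ℝ}
    {τ : ℝ} {p d : J → ℝ} {X : ℝ} {M : J → μ} {s : J → ℝ} (hX0 : 0 < X)
    (hσ0 : ∀ i ∈ A, 0 ≤ σ i) (hτ0 : 0 ≤ τ) (hστ : ∀ i ∈ A, σ i ≤ τ)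
    (hp : ∀ x ∈ Set.Icc 0 X, ∀ i, 0 ≤ p i + x * d i)
    (hd : ∀ x ∈ Set.Ico 0 X, ∀ i, d i ≠ 0 → 0 < p i + x * d i)
    (hAd : ∀ x ∈ Set.Ioo 0 X, ∀ i ∈ A, d i ≠ 0 → τ < σ i + (p i + x * d i))
    (h0 : ∀ (M' : J → μ) s', Extends res A σ τ p M' s' →
      ∑ j, (s j + p j) ≤ ∑ j, (s' j + p j))
    (hX : ∀ (M' : J → μ) s', Extends res A σ τ (fun j => p j + X * d j) M' s' →
      ∑ j, (s j + p j) ≤ ∑ j, (s' j + (p j + X * d j)))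
    (h : Extends res A σ τ p M s) (ha : Aligned res p M s)
    (hA : ∀ j ∈ A, shift p M s d j = 0) (hτ : ∀ j ∉ A, s j = τ → 0 ≤ shift p M s d j) :
    0 ≤ ∑ i, d i * tailCount p M s i := by
  have hd0 : ∀ i, d i ≠ 0 → 0 < p i := fun i hi => by
    simpa using hd 0 ⟨le_rfl, hX0⟩ i hi
  have hsmall : ∀ᶠ ε in 𝓝[>] (0 : ℝ), ε < X := nhdsWithin_le_nhds (gt_mem_nhds hX0)
  obtain ⟨ε, hε, hεX, hε0⟩ := ((h.eventually_shift ha hd0 hA hτ).and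
    (hsmall.and self_mem_nhdsWithin)).exists
  have hε0 : 0 < ε := hε0
  have hle := le_cost_of_endpoints hσ0 hτ0 hστ hp (fun x hx => hd x ⟨hx.1.le, hx.2⟩) hAd
    (by simpa using h0) hX ⟨hε0.le, hεX.le⟩ hε
  rw [sum_shifted] at hle
  by_contra hneg
  have := mul_neg_of_pos_of_neg hε0 (not_le.1 hneg)
  linarith

/-- `(M, s)` is compatible and minimizes the total completion time. -/
structure IsBest [Fintype J] (res : J → ρ) (p : J → ℝ) (M : J → μ) (s : J → ℝ) : Prop where
  compat : Compat res p M s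
  nonneg : ∀ j, 0 ≤ s j
  le : ∀ (M' : J → μ) (s' : J → ℝ), Compat res p M' s' → (∀ j, 0 ≤ s' j) →
    ∑ j, (s j + p j) ≤ ∑ j, (s' j + p j)

/-! ### Converting schedules with modified lengths back -/

section Conversion

variable {res : J → ρ} {p : J → ℝ}

open Classical in
/-- A schedule in which `k`, prolonged by `s b - s k`, is still running when the accordingly
shortened job `b` starts, can be converted by letting `b` start in place of `k` and `k` in place of `b`. -/
theorem Compat.exchange {p' : J → ℝ} {N : J → μ} {t : J → ℝ} {k b : J} (h : Compat res p' N t)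
    (hkb : t k < t b) (hpk : 0 < p k) (hk : p' k = p k + (t b - t k))
    (hpb : 0 < p' b) (hb : p' b = p b - (t b - t k)) (hp : ∀ j, j ≠ k → j ≠ b → p' j = p j)
    (hrk : res k ≠ res b)
    (hR : ∀ j, 0 < p' j → res j = res b → t j < t b → t j + p' j ≤ t k) :
    ∃ N' : J → μ, Compat res p N' (t ∘ Equiv.swap k b) := by
  classical
  have hne : k ≠ b := by rintro rfl; exact lt_irrefl _ hkb
  have hpk' : 0 < p' k := by linarith
  have hNkb : N k ≠ N b := by
    intro e
    rcases (h k b hne (.inl e)).of_pos hpk' hpb with h1 | h1 <;> linarith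
  have hbefore : ∀ j, j ≠ k → j ≠ b → 0 < p j → N j = N k → t j < t b → t j + p j ≤ t k := by
    intro j hjk hjb hj hm hlt
    have hj' : 0 < p' j := by rwa [hp j hjk hjb]
    have := (h j k hjk (.inl hm)).of_pos hj' hpk'
    rw [hp j hjk hjb] at this
    rcases this with h1 | h1 <;> linarith
  have hbefore' : ∀ j, j ≠ k → j ≠ b → 0 < p j → N j = N b → t j < t b → t j + p j ≤ t b := by
    intro j hjk hjb hj hm hlt
    have hj' : 0 < p' j := by rwa [hp j hjk hjb]
    have := (h j b hjb (.inl hm)).of_pos hj' hpb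
    rw [hp j hjk hjb] at this
    rcases this with h1 | h1 <;> linarith
  -- Both jobs keep their ends, as `t b + p k = t k + p' k` and `t k + p b = t b + p' b`, but change
  -- machines. Their successors must follow them, so the tails from `t b` on are exchanged.
  let N' : J → μ := fun j => if j = k then N b else if j = b then N k else
    swapTails N t (N k) (N b) (t b) j
  have hN'k : N' k = N b := by simp [N']
  have hN'b : N' b = N k := by simp [N', hne.symm]
  have hN' : ∀ j, j ≠ k → j ≠ b → N' j = swapTails N t (N k) (N b) (t b) j := by
    intro j h1 h2; simp [N', h1, h2]
  have hK : ∀ j, j ≠ k → j ≠ b → 0 < p j → (N' j = N' k ∨ res j = res k) →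
      t j + p j ≤ t b ∨ t b + p k ≤ t j := by
    intro j hjk hjb hj hc
    have hj' : 0 < p' j := by rwa [hp j hjk hjb]
    by_cases hlt : t j < t b
    · rcases hc with hc | hc
      · left
        have hm : N j = N b := by
          rw [hN' j hjk hjb, hN'k] at hc
          simpa [swapTails, hlt.not_ge] using hc
        exact hbefore' j hjk hjb hj hm hlt
      · have := (h j k hjk (.inr hc)).of_pos hj' hpk'
        rw [hp j hjk hjb] at this
        rcases this with h1 | h1
        · left; linarith
        · right; linarith
    · right
      have hc' : N j = N k ∨ res j = res k := by
        refine hc.imp (fun hc => ?_) id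
        rw [hN' j hjk hjb, hN'k] at hc
        rw [swapTails, if_pos (not_lt.1 hlt), Equiv.swap_apply_eq_iff, Equiv.swap_apply_right] at hc
        exact hc
      have := (h j k hjk hc').of_pos hj' hpk'
      rw [hp j hjk hjb] at this
      rcases this with h1 | h1 <;> linarith
  have hB : ∀ j, j ≠ k → j ≠ b → 0 < p j → (N' j = N' b ∨ res j = res b) →
      t j + p j ≤ t k ∨ t k + p b ≤ t j := by
    intro j hjk hjb hj hc
    have hj' : 0 < p' j := by rwa [hp j hjk hjb]
    by_cases hlt : t j < t b
    · left
      rcases hc with hc | hc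
      · have hm : N j = N k := by
          rw [hN' j hjk hjb, hN'b] at hc
          simpa [swapTails, hlt.not_ge] using hc
        exact hbefore j hjk hjb hj hm hlt
      · rw [← hp j hjk hjb]
        exact hR j hj' hc hlt
    · right
      have hc' : N j = N b ∨ res j = res b := by
        refine hc.imp (fun hc => ?_) id
        rw [hN' j hjk hjb, hN'b] at hc
        rw [swapTails, if_pos (not_lt.1 hlt), Equiv.swap_apply_eq_iff, Equiv.swap_apply_left] at hc
        exact hc
      have := (h j b hjb hc').of_pos hj' hpb
      rw [hp j hjk hjb] at this
      rcases this with h1 | h1 <;> linarith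
  refine ⟨N', fun i j hij hc => ?_⟩
  have hkb' : ¬ (N' k = N' b ∨ res k = res b) := by
    rw [hN'k, hN'b]
    rintro (e | e)
    · exact hNkb e.symm
    · exact hrk e
  refine sep_of_pos fun hi hj => ?_
  by_cases hik : i = k
  · subst hik
    by_cases hjb : j = b
    · subst hjb; exact absurd hc hkb'
    · have := hK j hij.symm hjb hj (hc.imp Eq.symm Eq.symm)
      simpa [Equiv.swap_apply_of_ne_of_ne hij.symm hjb] using this.symm
  · by_cases hib : i = b
    · subst hib
      by_cases hjk : j = k
      · subst hjk; exact absurd (hc.imp Eq.symm Eq.symm) hkb'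
      · have := hB j hjk hij.symm hj (hc.imp Eq.symm Eq.symm)
        simpa [Equiv.swap_apply_of_ne_of_ne hjk hij.symm] using this.symm
    · by_cases hjk : j = k
      · subst hjk
        simpa [Equiv.swap_apply_of_ne_of_ne hik hib] using hK i hik hib hi hc
      · by_cases hjb : j = b
        · subst hjb
          simpa [Equiv.swap_apply_of_ne_of_ne hik hib] using hB i hik hib hi hc
        · simp only [Function.comp, Equiv.swap_apply_of_ne_of_ne hik hib,
            Equiv.swap_apply_of_ne_of_ne hjk hjb]
          have hi' : 0 < p' i := by rwa [hp i hik hib]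
          have hj' : 0 < p' j := by rwa [hp j hjk hjb]
          rw [← hp i hik hib, ← hp j hjk hjb]
          rcases hc with hc | hc
          · rw [hN' i hik hib, hN' j hjk hjb] at hc
            rcases swapTails_eq hc with hc | ⟨h1, h2, h3⟩ | ⟨h1, h2, h3⟩
            · exact (h i j hij (.inl hc)).of_pos hi' hj'
            · left
              rw [hp i hik hib]
              rcases h3 with h3 | h3
              · linarith [hbefore i hik hib hi h3 h1]
              · linarith [hbefore' i hik hib hi h3 h1]
            · right
              rw [hp j hjk hjb]
              rcases h3 with h3 | h3
              · linarith [hbefore j hjk hjb hj h3 h1]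
              · linarith [hbefore' j hjk hjb hj h3 h1]
          · exact (h i j hij (.inr hc)).of_pos hi' hj'

open Classical in
/-- A schedule in which `k` is prolonged by the length of a vanished job `b` can be converted by
letting `b` use the initial part of the period of `k`. -/
theorem Compat.insert {p' : J → ℝ} {N : J → μ} {t : J → ℝ} {k b : J} (h : Compat res p' N t)
    (hpk : 0 < p k) (hpb : 0 ≤ p b) (hk : p' k = p k + p b)
    (hp : ∀ j, j ≠ k → j ≠ b → p' j = p j) (hkb : k ≠ b)
    (hR : ∀ j, j ≠ k → 0 < p' j → res j = res b → t j + p' j ≤ t k ∨ t k + p b ≤ t j) :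
    ∃ N' : J → μ, Compat res p N' (Function.update (Function.update t k (t k + p b)) b (t k)) := by
  classical
  have hpk' : 0 < p' k := by linarith
  set t' := Function.update (Function.update t k (t k + p b)) b (t k) with ht'
  have tk : t' k = t k + p b := by simp [ht', hkb]
  have tb : t' b = t k := by simp [ht']
  have tj : ∀ j, j ≠ k → j ≠ b → t' j = t j := by
    intro j h1 h2; simp [ht', h1, h2]
  have hN : ∀ j, j ≠ k → j ≠ b → 0 < p j → (N j = N k ∨ res j = res k) →
      t j + p j ≤ t k ∨ t k + p k + p b ≤ t j := by
    intro j hjk hjb hj hc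
    have := (h j k hjk hc).of_pos (by rwa [hp j hjk hjb]) hpk'
    rw [hp j hjk hjb] at this
    refine this.imp id fun h => by linarith
  have hK : ∀ j, j ≠ k → j ≠ b → 0 < p j → (Function.update N b (N k) j =
      Function.update N b (N k) k ∨ res j = res k) →
      t' j + p j ≤ t' k ∨ t' k + p k ≤ t' j := by
    intro j hjk hjb hj hc
    rw [Function.update_of_ne hjb, Function.update_of_ne hkb] at hc
    rw [tj j hjk hjb, tk]
    exact (hN j hjk hjb hj hc).imp (fun h => by linarith) fun h => by linarith
  have hB : ∀ j, j ≠ b → 0 < p j → (Function.update N b (N k) j =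
      Function.update N b (N k) b ∨ res j = res b) →
      t' j + p j ≤ t' b ∨ t' b + p b ≤ t' j := by
    intro j hjb hj hc
    by_cases hjk : j = k
    · right; rw [hjk, tb, tk]
    · rw [Function.update_of_ne hjb, Function.update_self] at hc
      rw [tj j hjk hjb, tb]
      rcases hc with hc | hc
      · exact (hN j hjk hjb hj (.inl hc)).imp id fun h => by linarith
      · have := hR j hjk (by rwa [hp j hjk hjb]) hc
        rwa [hp j hjk hjb] at this
  refine ⟨Function.update N b (N k), fun i j hij hc => sep_of_pos fun hi hj => ?_⟩
  by_cases hib : i = b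
  · subst hib
    exact (hB j hij.symm hj (hc.imp Eq.symm Eq.symm)).symm
  · by_cases hjb : j = b
    · subst hjb
      exact hB i hib hi hc
    · by_cases hik : i = k
      · subst hik
        exact (hK j hij.symm hjb hj (hc.imp Eq.symm Eq.symm)).symm
      · by_cases hjk : j = k
        · subst hjk
          exact hK i hik hib hi hc
        · rw [tj i hik hib, tj j hjk hjb]
          rw [Function.update_of_ne hib, Function.update_of_ne hjb] at hc
          have := (h i j hij hc).of_pos (by rwa [hp i hik hib]) (by rwa [hp j hjk hjb])
          rwa [hp i hik hib, hp j hjk hjb] at this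

end Conversion

/-! ### Jobs of a common resource in a best schedule -/

section Best

variable [Fintype J] {res : J → ρ} {p : J → ℝ} {M : J → μ} {s : J → ℝ}

theorem tailCount_lt {i j : J} (hj : 0 < p j) (hm : M i = M j) (hs : s i < s j) :
    tailCount p M s j < tailCount p M s i := by
  classical
  unfold tailCount
  gcongr
  rw [Finset.ssubset_iff_of_subset]
  · exact ⟨j, by simp [hj, hm, hs], by simp⟩
  · intro l hl
    simp only [Finset.mem_filter, Finset.mem_univ, true_and] at hl ⊢
    exact ⟨hl.1, hm.trans hl.2.1, hs.trans hl.2.2⟩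

open Classical in
theorem sum_single_sub_single_mul (f : J → ℝ) (u v : J) :
    ∑ i, (Pi.single u (1 : ℝ) - Pi.single v (1 : ℝ) : J → ℝ) i * f i = f u - f v := by
  simp [sub_mul, Finset.sum_sub_distrib, Pi.single_apply]

/-- Of two jobs with the same resource, the longer one is followed by fewer jobs. -/
theorem IsBest.tailCount_le [Finite μ] (h : IsBest res p M s) (hp : ∀ j, 0 ≤ p j)
    (ha : Aligned res p M s) {a b : J} (hr : res a = res b) (hb : 0 < p b) (hab : p b < p a) :
    tailCount p M s a ≤ tailCount p M s b := by
  classical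
  have hne : a ≠ b := by rintro rfl; exact lt_irrefl _ hab
  -- At `x = p a - p b` the two lengths are interchanged. As the resource is common, this is the
  -- original instance with `a` and `b` renamed.
  set d : J → ℝ := Pi.single b (1 : ℝ) - Pi.single a (1 : ℝ) with hd
  have da : d a = -1 := by simp [hd, hne]
  have db : d b = 1 := by simp [hd, hne.symm]
  have dz : ∀ i, i ≠ a → i ≠ b → d i = 0 := by
    intro i h1 h2
    simp [hd, h1, h2]
  have hswap : ∀ j, p j + (p a - p b) * d j = p (Equiv.swap a b j) := by
    intro j
    by_cases h1 : j = a
    · subst h1; rw [da, Equiv.swap_apply_left]; ring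
    · by_cases h2 : j = b
      · subst h2; rw [db, Equiv.swap_apply_right]; ring
      · rw [dz j h1 h2, Equiv.swap_apply_of_ne_of_ne h1 h2]; ring
  have hres : ∀ j, res (Equiv.swap a b j) = res j := by
    intro j
    by_cases h1 : j = a
    · subst h1; rw [Equiv.swap_apply_left, hr]
    · by_cases h2 : j = b
      · subst h2; rw [Equiv.swap_apply_right, hr]
      · rw [Equiv.swap_apply_of_ne_of_ne h1 h2]
  have hpos : ∀ x ∈ Set.Icc 0 (p a - p b), ∀ i, d i ≠ 0 → 0 < p i + x * d i := by
    intro x hx i hi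
    by_cases h1 : i = a
    · subst h1; rw [da]; linarith [hx.2]
    · by_cases h2 : i = b
      · subst h2; rw [db]; linarith [hx.1]
      · exact absurd (dz i h1 h2) hi
  have hext : Extends res ∅ s 0 p M s := ⟨h.compat, by simp, fun i _ => h.nonneg i⟩
  have hzero : ∀ j, s j ≤ 0 → shift p M s d j = 0 := fun j hj =>
    shift_eq_zero_of_start_le hext (fun i hi => by
      simpa using hpos 0 ⟨le_rfl, by linarith⟩ i hi) (by simp) hj
  have key := nonneg_slope_of_endpoints (A := ∅) (σ := s) (τ := 0) (X := p a - p b) (d := d)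
    (by linarith) (by simp) le_rfl (by simp)
    (fun x hx i => by
      by_cases hi : d i = 0
      · simpa [hi] using hp i
      · exact (hpos x hx i hi).le)
    (fun x hx => hpos x ⟨hx.1, hx.2.le⟩) (by simp)
    (fun M' s' h' => h.le M' s' h'.compat fun j => h'.release j (by simp))
    (fun M' s' h' => by
      simp only [hswap] at h' ⊢
      have := h.le (M' ∘ Equiv.swap a b) (s' ∘ Equiv.swap a b) (by
        intro i j hij hc
        have := h'.compat (Equiv.swap a b i) (Equiv.swap a b j)
          (fun e => hij ((Equiv.swap a b).injective e)) (by simpa [hres] using hc)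
        simpa [Sep] using this) (fun j => h'.release _ (by simp))
      refine this.trans_eq ?_
      rw [← Equiv.sum_comp (Equiv.swap a b) fun j => s' j + p (Equiv.swap a b j)]
      simp)
    hext ha (by simp) (fun j _ hj => (hzero j hj.le).ge)
  rw [hd, sum_single_sub_single_mul] at key
  linarith

/-- If `b` is processed later on another machine than `a`, with no job of its resource in between,
then the machine of `a` is not left idle before `b` starts. -/
theorem IsBest.exists_straddling (h : IsBest res p M s) {a b : J} (hr : res a = res b)
    (hpa : 0 < p a) (hpb : 0 < p b) (hs : s a < s b)
    (hadj : ∀ j, 0 < p j → res j = res a → s j < s b → s j ≤ s a) :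
    ∃ k, 0 < p k ∧ M k = M a ∧ s a ≤ s k ∧ s k < s b ∧ s b ≤ s k + p k ∧
      ∀ j, 0 < p j → M j = M a → s j < s b → s j ≤ s k := by
  classical
  obtain ⟨k, hk, hmax⟩ := Finset.exists_max_image
    (Finset.univ.filter fun j => 0 < p j ∧ M j = M a ∧ s j < s b) s
    ⟨a, by simp [hpa, hs]⟩
  simp only [Finset.mem_filter, Finset.mem_univ, true_and] at hk hmax
  obtain ⟨hpk, hmk, hsk⟩ := hk
  have hak : s a ≤ s k := hmax a ⟨hpa, rfl, hs⟩
  refine ⟨k, hpk, hmk, hak, hsk, ?_, fun j h1 h2 h3 => hmax j ⟨h1, h2, h3⟩⟩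
  -- Otherwise exchanging the tails at `s b` puts `b` on the machine of `k`, where it can start at
  -- the end of `k`; by `hadj` its resource is free then, and the cost drops.
  by_contra! hlt
  have hleA : ∀ j, 0 < p j → M j = M a → s j < s b → s j + p j ≤ s k + p k := by
    intro j hj hm hsj
    by_cases hjk : j = k
    · rw [hjk]
    · have h1 := hmax j ⟨hj, hm, hsj⟩
      rcases (h.compat j k hjk (.inl (hm.trans hmk.symm))).of_pos hj hpk with h2 | h2 <;> linarith
  have hleB : ∀ j, 0 < p j → M j = M b → s j < s b → s j + p j ≤ s b := by
    intro j hj hm hsj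
    exact (h.compat j b (fun e => by rw [e] at hsj; exact lt_irrefl _ hsj) (.inl hm)).le_of_lt
      hj hpb hsj
  have hleR : ∀ j, 0 < p j → res j = res b → s j < s b → s j + p j ≤ s k + p k := by
    intro j hj hm hsj
    have h1 := hadj j hj (hm.trans hr.symm) hsj
    have h2 := hleA a hpa rfl hs
    by_cases hja : j = a
    · rw [hja]; exact h2
    · rcases (h.compat j a hja (.inr (hm.trans hr.symm))).of_pos hj hpa with h3 | h3 <;> linarith
  have hsw : Compat res p (swapTails M s (M a) (M b) (s b)) s := by
    refine h.compat.exchange_tails ?_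
    rintro j hj (hm | hm) hsj
    · exact (hleA j hj hm hsj).trans hlt.le
    · exact hleB j hj hm hsj
  have hb : ∀ j, j ≠ b → (swapTails M s (M a) (M b) (s b) j = swapTails M s (M a) (M b) (s b) b ∨
      res j = res b) → 0 < p j → s j + p j ≤ s k + p k ∨ s k + p k + p b ≤ s j := by
    intro j hjb hc hj
    by_cases hsj : s j < s b
    · left
      rcases hc with hc | hc
      · have hm : M j = M a := by simpa [swapTails, hsj.not_ge] using hc
        exact hleA j hj hm hsj
      · exact hleR j hj hc hsj
    · right
      rcases (hsw j b hjb hc).of_pos hj hpb with h1 | h1 <;> linarith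
  have hcompat : Compat res p (swapTails M s (M a) (M b) (s b))
      (Function.update s b (s k + p k)) := by
    intro i j hij hc
    refine sep_of_pos fun hi hj => ?_
    by_cases hib : i = b
    · subst hib
      have hji := hij.symm
      simp only [Function.update_self, Function.update_of_ne hji]
      exact (hb j hji (hc.imp Eq.symm Eq.symm) hj).symm
    · by_cases hjb : j = b
      · subst hjb
        simp only [Function.update_self, Function.update_of_ne hib]
        exact hb i hib hc hi
      · simp only [Function.update_of_ne hib, Function.update_of_ne hjb]
        exact (hsw i j hij hc).of_pos hi hj
  have hk0 := h.nonneg k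
  have hle := h.le _ _ hcompat (fun j => by
    by_cases hjb : j = b
    · subst hjb; simp only [Function.update_self]; linarith
    · simpa [Function.update_of_ne hjb] using h.nonneg j)
  refine absurd hle (not_le.2 ?_)
  refine Finset.sum_lt_sum (fun j _ => ?_) ⟨b, Finset.mem_univ _, by simpa using hlt⟩
  by_cases hjb : j = b
  · subst hjb; simpa using hlt.le
  · simp [Function.update_of_ne hjb]

/-- Of two consecutive jobs of the same resource, the first one is not longer. -/
theorem IsBest.adjacent_le [Finite μ] (h : IsBest res p M s) (hp : ∀ j, 0 ≤ p j)
    (ha : Aligned res p M s) {a b : J} (hr : res a = res b) (hpb : 0 < p b) (hs : s a < s b)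
    (hadj : ∀ j, 0 < p j → res j = res a → s j < s b → s j ≤ s a) : p a ≤ p b := by
  classical
  by_contra! hab
  have hpa : 0 < p a := hpb.trans hab
  have hN := h.tailCount_le hp ha hr hpb hab
  have hM : M a ≠ M b := fun e => absurd hN (not_le.2 (tailCount_lt hpb e hs))
  obtain ⟨k, hpk, hMk, hak, hkb, hCk, hmax⟩ := h.exists_straddling hr hpa hpb hs hadj
  have hab' : a ≠ b := by rintro rfl; exact lt_irrefl _ hs
  have hne : k ≠ b := by rintro rfl; exact lt_irrefl _ hkb
  have hCa : s a + p a ≤ s b := (h.compat a b hab' (.inr hr)).le_of_lt hpa hpb hs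
  have hka : k ≠ a := by
    rintro rfl
    exact hM (ha k b hpk hpb hr (le_antisymm hCa hCk))
  have hCak : s a + p a ≤ s k := by
    rcases (h.compat a k hka.symm (.inl hMk.symm)).of_pos hpa hpk with h1 | h1
    · exact h1
    · linarith
  have hrk : res k ≠ res b := by
    intro e
    have := hadj k hpk (e.trans hr.symm) hkb
    linarith
  have hRb : ∀ j, 0 < p j → res j = res b → s j < s b → s j + p j ≤ s k := by
    intro j hj hm hsj
    have h1 := hadj j hj (hm.trans hr.symm) hsj
    by_cases hja : j = a
    · rw [hja]; exact hCak
    · rcases (h.compat j a hja (.inr (hm.trans hr.symm))).of_pos hj hpa with h3 | h3 <;> linarith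
  set d : J → ℝ := Pi.single k (1 : ℝ) - Pi.single b (1 : ℝ) with hd
  have dk : d k = 1 := by simp [hd, hne]
  have db : d b = -1 := by simp [hd, hne.symm]
  have dz : ∀ i, i ≠ k → i ≠ b → d i = 0 := by
    intro i h1 h2
    simp [hd, h1, h2]
  have dcases : ∀ i, d i ≠ 0 → i = k ∨ i = b := by
    intro i hi
    by_contra! hc
    exact hi (dz i hc.1 hc.2)
  -- The conversions need to know what uses the resource of `b` before `s b`, so these starting
  -- times are frozen.
  let A : Set J := {j | s j < s b ∨ j = b}
  have hkA : k ∈ A := .inl hkb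
  have hbA : b ∈ A := .inr rfl
  -- The segment ends either when `b` is used up, where `Compat.insert` applies, or when `k` has
  -- gained `s b - s k`, where `Compat.exchange` applies.
  set X := min (s b - s k) (p b) with hX
  have hX0 : 0 < X := lt_min (by linarith) hpb
  have hX1 : X ≤ s b - s k := min_le_left _ _
  have hX2 : X ≤ p b := min_le_right _ _
  have hext : Extends res A s (s b) p M s := by
    refine ⟨h.compat, fun _ _ => rfl, fun i hi => ?_⟩
    by_contra! hlt
    exact hi (.inl hlt)
  have hs0 : ∀ {p' : J → ℝ} {M' : J → μ} {s' : J → ℝ}, Extends res A s (s b) p' M' s' →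
      ∀ j, 0 ≤ s' j := by
    intro p' M' s' h' j
    by_cases hj : j ∈ A
    · rw [h'.fixed j hj]; exact h.nonneg j
    · exact (h.nonneg b).trans (h'.release j hj)
  have hshift : ∀ j, (∀ i, d i ≠ 0 → M i = M j → s i < s j → i = k) → 0 ≤ shift p M s d j := by
    intro j hj
    unfold shift
    split_ifs
    · refine Finset.sum_nonneg fun i _ => ?_
      split_ifs with hc
      · by_cases hi : d i = 0
        · rw [hi]
        · rw [hj i hi hc.1 hc.2, dk]; exact zero_le_one
      · exact le_rfl
    · exact le_rfl
  have key := nonneg_slope_of_endpoints (A := A) (σ := s) (τ := s b) (X := X) (d := d)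
    hX0 (fun i _ => h.nonneg i) (h.nonneg b)
    (by rintro i (hi | rfl)
        · exact hi.le
        · exact le_rfl)
    (fun x hx i => by
      by_cases hi : d i = 0
      · simpa [hi] using hp i
      · rcases dcases i hi with rfl | rfl
        · rw [dk]; linarith [hx.1]
        · rw [db]; linarith [hx.2])
    (fun x hx i hi => by
      rcases dcases i hi with rfl | rfl
      · rw [dk]; linarith [hx.1]
      · rw [db]; linarith [hx.2])
    (fun x hx i _ hi => by
      rcases dcases i hi with rfl | rfl
      · rw [dk]; linarith [hx.1]
      · rw [db]; linarith [hx.2])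
    (fun M' s' h' => h.le M' s' h'.compat (hs0 h'))
    (fun N t h' => by
      have htk : t k = s k := h'.fixed k hkA
      have htb : t b = s b := h'.fixed b hbA
      have hpj : ∀ j, j ≠ k → j ≠ b → p j + X * d j = p j := by
        intro j h1 h2; rw [dz j h1 h2]; ring
      have htR : ∀ j, j ≠ k → j ≠ b → t j < t b → t j = s j ∧ s j < s b := by
        intro j h1 h2 hlt
        have hjA : j ∈ A := by
          by_contra hjA
          have := h'.release j hjA
          linarith
        exact ⟨h'.fixed j hjA, hjA.resolve_right h2⟩
      rcases le_or_gt (p b) (s b - s k) with hle | hle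
      · have hXe : X = p b := min_eq_right hle
        rw [hXe] at h' hpj ⊢
        obtain ⟨N', hN'⟩ := h'.compat.insert (p := p) (k := k) (b := b) hpk hpb.le
          (by rw [dk]; ring) hpj hne (by
            intro j hjk hj hrj
            by_cases hjb : j = b
            · right; rw [hjb]; linarith
            by_cases hlt : t j < t b
            · obtain ⟨e1, e2⟩ := htR j hjk hjb hlt
              simp only [hpj j hjk hjb] at hj ⊢
              left
              rw [e1, htk]
              exact hRb j hj hrj e2
            · right; linarith)
        refine (h.le N' _ hN' fun j => ?_).trans ?_
        · by_cases hjb : j = b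
          · subst hjb; simpa using hs0 h' k
          · rw [Function.update_of_ne hjb]
            by_cases hjk : j = k
            · subst hjk; simpa using add_nonneg (hs0 h' j) hpb.le
            · rw [Function.update_of_ne hjk]; exact hs0 h' j
        -- The end of `k` is unchanged. Job `b`, of length zero at `s b`, contributed `s b` and now
        -- ends at `s k + p b ≤ s b`.
        · refine Finset.sum_le_sum fun j _ => ?_
          by_cases hjb : j = b
          · subst hjb; rw [Function.update_self, db]; linarith
          · rw [Function.update_of_ne hjb]
            by_cases hjk : j = k
            · subst hjk; rw [Function.update_self, dk]; linarith
            · rw [Function.update_of_ne hjk, hpj j hjk hjb]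
      · have hXe : X = s b - s k := min_eq_left hle.le
        rw [hXe] at h' hpj ⊢
        obtain ⟨N', hN'⟩ := h'.compat.exchange (p := p) (k := k) (b := b)
          (by rw [htk, htb]; exact hkb) hpk (by rw [dk, htk, htb]; ring)
          (by rw [db]; linarith) (by rw [db, htk, htb]; ring) hpj hrk (by
            intro j hj hrj hltj
            have hjb : j ≠ b := by rintro rfl; exact lt_irrefl _ hltj
            have hjk : j ≠ k := by rintro rfl; exact hrk hrj
            obtain ⟨e1, e2⟩ := htR j hjk hjb hltj
            simp only [hpj j hjk hjb] at hj ⊢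
            rw [e1, htk]
            exact hRb j hj hrj e2)
        refine (h.le N' _ hN' fun j => hs0 h' _).trans_eq ?_
        have e1 : ∑ j, (t ∘ Equiv.swap k b) j = ∑ j, t j :=
          Equiv.sum_comp (Equiv.swap k b) t
        have e2 : ∑ j, (s b - s k) * d j = 0 := by
          rw [← Finset.mul_sum, hd]
          simp [Finset.sum_sub_distrib]
        rw [Finset.sum_add_distrib, e1, Finset.sum_add_distrib, Finset.sum_add_distrib, e2,
          add_zero])
    hext ha
    -- No frozen job moves: `k` is the last on its machine to start before `s b`, and `b` is on
    -- another machine.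
    (fun j hj => by
      unfold shift
      split_ifs with hpj
      · refine Finset.sum_eq_zero fun i _ => ?_
        split_ifs with hc
        · by_contra hi
          rcases dcases i hi with rfl | rfl
          · rcases hj with hj | rfl
            · have := hmax j hpj (hc.1.symm.trans hMk) hj
              linarith [hc.2]
            · exact hM (hMk.symm.trans hc.1)
          · rcases hj with hj | rfl
            · linarith [hc.2]
            · exact lt_irrefl _ hc.2
        · rfl
      · rfl)
    (fun j _ hj => hshift j fun i hi _ hlt => by
      rcases dcases i hi with rfl | rfl
      · rfl
      · linarith)
  rw [hd, sum_single_sub_single_mul] at key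
  -- Now `n b ≤ n k < n a ≤ n b`, where `n` is `tailCount`.
  have := tailCount_lt hpk hMk.symm (show s a < s k by linarith)
  linarith

/-- Jobs of the same resource are processed in order of their lengths. -/
theorem IsBest.le_of_start_lt [Finite μ] (h : IsBest res p M s) (hp : ∀ j, 0 ≤ p j) {a b : J}
    (hr : res a = res b) (hpb : 0 < p b) (hs : s a < s b) : p a ≤ p b := by
  classical
  obtain ⟨M', hM', hal⟩ := h.compat.exists_aligned
  have h' : IsBest res p M' s := ⟨hM', h.nonneg, h.le⟩
  by_contra! hlt
  -- In a violating pair with least gap, a job of the resource starting in between would form a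
  -- closer violating pair: with `u` if it is shorter than `u`, with `v` otherwise.
  obtain ⟨⟨u, v⟩, huv, hmin⟩ := Finset.exists_min_image
    (Finset.univ.filter fun q : J × J =>
      0 < p q.2 ∧ res q.1 = res q.2 ∧ s q.1 < s q.2 ∧ p q.2 < p q.1) (fun q => s q.2 - s q.1)
    ⟨(a, b), by simp [hpb, hr, hs, hlt]⟩
  simp only [Finset.mem_filter, Finset.mem_univ, true_and] at huv hmin
  obtain ⟨hv, hruv, hsuv, hpuv⟩ := huv
  refine absurd (h'.adjacent_le hp hal hruv hv hsuv fun j hj hrj hsj => ?_) (not_le.2 hpuv)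
  by_contra! hju
  by_cases hjp : p j < p u
  · have := hmin (u, j) ⟨hj, hrj.symm, hju, hjp⟩
    simp only at this
    linarith
  · have := hmin (j, v) ⟨hv, hrj.trans hruv, hsj, by simp only; linarith⟩
    simp only at this
    linarith

end Best

end Sweep

/-! ### Translation to feasible and optimal schedules -/

theorem exists_resource_map {J : Type*} (I : PartitionInstance J) :
    ∃ res : J → Finset J, (∀ j, res j ∈ I.R ∧ j ∈ res j) ∧ ∀ r ∈ I.R, ∀ j ∈ r, res j = r := by
  choose res h1 h2 using I.partition
  exact ⟨res, h1, fun r hr j hj => (h2 j r ⟨hr, hj⟩).symm⟩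

theorem Schedule.disjoint_processing_iff {J : Type*} {I : PartitionInstance J} (S : Schedule I)
    (i j : J) : Disjoint (S.processing i) (S.processing j) ↔ Sep I.p S.start i j := by
  have h1 := I.p_nonneg i
  have h2 := I.p_nonneg j
  simp only [Schedule.processing, Schedule.completion, Set.Ico_disjoint_Ico, Sep, min_le_iff,
    le_max_iff]
  constructor
  · rintro ((h | h) | (h | h))
    · left; linarith
    · right; right; right; linarith
    · right; right; left; linarith
    · right; left; linarith
  · rintro (h | h | h | h)
    · left; left; linarith
    · right; right; linarith
    · right; left; linarith
    · left; right; linarith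

theorem Schedule.feasible_iff {J : Type*} {I : PartitionInstance J} {res : J → Finset J}
    (h1 : ∀ j, res j ∈ I.R ∧ j ∈ res j) (h2 : ∀ r ∈ I.R, ∀ j ∈ r, res j = r) (S : Schedule I) :
    S.Feasible ↔ (∀ j, 0 ≤ S.start j) ∧ Compat res I.p S.machine S.start := by
  constructor
  · intro h
    refine ⟨h.start_nonneg, fun i j hij hc => ?_⟩
    rw [← S.disjoint_processing_iff]
    rcases hc with hc | hc
    · exact h.machine_disjoint i j hij hc
    · exact h.resource_disjoint (res i) (h1 i).1 i (h1 i).2 j (hc ▸ (h1 j).2) hij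
  · rintro ⟨h, hc⟩
    refine ⟨h, fun i j hij hm => ?_, fun r hr i hi j hj hij => ?_⟩
    · exact (S.disjoint_processing_iff i j).2 (hc i j hij (.inl hm))
    · exact (S.disjoint_processing_iff i j).2 (hc i j hij (.inr ((h2 r hr i hi).trans
        (h2 r hr j hj).symm)))

theorem Schedule.Optimal.isBest {J : Type*} [Fintype J] {I : PartitionInstance J}
    {res : J → Finset J} (h1 : ∀ j, res j ∈ I.R ∧ j ∈ res j)
    (h2 : ∀ r ∈ I.R, ∀ j ∈ r, res j = r) {S : Schedule I} (hS : S.Optimal) :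
    IsBest res I.p S.machine S.start := by
  obtain ⟨h3, h4⟩ := (S.feasible_iff h1 h2).1 hS.1
  exact ⟨h4, h3, fun M' s' hc h0 => hS.2 ⟨M', s'⟩ ((feasible_iff h1 h2 _).2 ⟨h0, hc⟩)⟩

/-- In an optimal schedule, jobs of length zero are completed at time zero. -/
theorem IsBest.start_eq_zero {J ρ μ : Type*} [Fintype J] {res : J → ρ} {p : J → ℝ} {M : J → μ}
    {s : J → ℝ} (h : IsBest res p M s) {j : J} (hj : p j = 0) : s j = 0 := by
  classical
  refine le_antisymm ?_ (h.nonneg j)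
  by_contra! hlt
  have hc : Compat res p M (Function.update s j 0) := by
    intro a b hab hc
    refine sep_of_pos fun ha hb => ?_
    have ha' : a ≠ j := by rintro rfl; linarith
    have hb' : b ≠ j := by rintro rfl; linarith
    rw [Function.update_of_ne ha', Function.update_of_ne hb']
    exact (h.compat a b hab hc).of_pos ha hb
  have hle := h.le M _ hc fun i => by
    by_cases hi : i = j
    · subst hi; simp
    · rw [Function.update_of_ne hi]; exact h.nonneg i
  refine absurd hle (not_le.2 (Finset.sum_lt_sum (fun i _ => ?_)
    ⟨j, Finset.mem_univ _, by simpa using hlt⟩))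
  by_cases hi : i = j
  · subst hi; simpa using hlt.le
  · rw [Function.update_of_ne hi]

end PartitionInstance

theorem mainTheorem2 {J : Type*} [Fintype J] (I : PartitionInstance J)
    (S : PartitionInstance.Schedule I) (hS : S.Optimal)
    (r : Finset J) (hr : r ∈ I.R) (j j' : J) (hj : j ∈ r) (hj' : j' ∈ r)
    (hp : I.p j < I.p j') :
    S.completion j < S.completion j' := by
  obtain ⟨res, h1, h2⟩ := I.exists_resource_map
  have hbest := hS.isBest h1 h2
  have hres : res j' = res j := (h2 r hr j' hj').trans (h2 r hr j hj).symm
  have hj'0 : 0 < I.p j' := (I.p_nonneg j).trans_lt hp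
  have hne : j' ≠ j := by rintro rfl; exact lt_irrefl _ hp
  unfold PartitionInstance.Schedule.completion
  -- The ordering result needs the shorter job to have positive length; a job of length zero
  -- completes at time zero, before `j'` does.
  rcases (I.p_nonneg j).eq_or_lt with h0 | h0
  · rw [hbest.start_eq_zero h0.symm, ← h0]
    linarith [hbest.nonneg j']
  · by_contra! hle
    rcases (hbest.compat j' j hne (.inr hres)).of_pos hj'0 h0 with h3 | h3
    · exact absurd (hbest.le_of_start_lt I.p_nonneg hres h0 (by linarith)) (not_le.2 hp)
    · linarith
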